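/- For integers $n\ge 2$ and $1\le\nu\le n-1$ let $$C_n(\nu)=\sum_{l=1}^{n-1}\cos\frac{2\pi\nu l}{n}\,\csc\frac{\pi l}{n}.$$ As $n\to\infty$, $$C_n(\nu)\;\sim\;-\frac{2n}{\pi}\ln\Bigl(2\sin\frac{\pi\nu}{n}\Bigr),\qquad \nu\neq\frac n6,\ \nu\neq\frac{5n}6,$$ uniformly in $\nu$: for every $\varepsilon>0$ there is $n_0$ such that for all $n\ge n_0$ and all integers $1\le\nu\le n-1$ with $\nu\ne n/6$ and $\nu\ne 5n/6$, $$\left|C_n(\nu)+\frac{2n}{\pi}\ln\Bigl(2\sin\frac{\pi\nu}{n}\Bigr)\right|\le\varepsilon\left|\frac{2n}{\pi}\ln\Bigl(2\sin\frac{\pi\nu}{n}\Bigr)\right|.$$ At $\nu=n/6$ and at $\nu=5n/6$ the logarithm $\ln\bigl(2\sin\frac{\pi\nu}{n}\bigr)$ vanishes, and the asymptotic relation is not valid: for $n=6m$ with $m\to\infty$, neither $C_{6m}(m)$ nor $C_{6m}(5m)$ is asymptotically equivalent to its (zero) leading term, i.e. neither is zero for all sufficiently large $m$. -/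

import Mathlib

/-- The trigonometric sum `C_n(ν) = ∑_{l=1}^{n-1} cos (2πνl/n) · csc (πl/n)`. -/
noncomputable def cosecantSum (n ν : ℕ) : ℝ :=
  ∑ l ∈ Finset.Ico 1 n,
    Real.cos (2 * Real.pi * (ν : ℝ) * (l : ℝ) / (n : ℝ)) *
      (1 / Real.sin (Real.pi * (l : ℝ) / (n : ℝ)))

/-- The leading term `-(2n/π) · ln (2 sin (πν/n))`. -/
noncomputable def leadingTerm (n ν : ℕ) : ℝ :=
  -(2 * (n : ℝ) / Real.pi) * Real.log (2 * Real.sin (Real.pi * (ν : ℝ) / (n : ℝ)))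

/-- `n → ∞`, uniformly in the second variable `ν`, which ranges over the integers
`1 ≤ ν ≤ n - 1` with `ν ≠ n/6` and `ν ≠ 5n/6`. -/
def largeAdmissible : Filter (ℕ × ℕ) :=
  Filter.comap Prod.fst Filter.atTop ⊓
    Filter.principal {p : ℕ × ℕ | 1 ≤ p.2 ∧ p.2 < p.1 ∧ 6 * p.2 ≠ p.1 ∧ 6 * p.2 ≠ 5 * p.1}

open Real Finset Filter Topology

/-! Write E_n(ν) for `cosecantError`. The difference C_n(ν+1) - C_n(ν) is exactly -2
cot((2ν+1)π/(2n)), the midpoint-rule value for the corresponding difference of the leading term,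
since log sin is a primitive of cot. As cot is convex on (0, π/2], E_n increases strictly for 1 ≤ ν
≤ n/2, by at most n/ν³ per step (`cosecantError_succ`), and it is symmetric under ν ↦ n - ν.

Both terms satisfy a duplication relation, so 2E_k(r) = E_{2k}(r) + E_{2k}(r+k). Applied twice, it
makes E_k(r) the mean of four values of E_{4k}, each at most the central value E_{4k}(2k). That
value tends to 0 (`tendsto_cosecantError_center`) and increases strictly when k is doubled, so it is
negative. Hence E_k(r) < 0 throughout, and C_n < 0 where the logarithm vanishes. Summing the
increments gives |E_k(r)| ≤ |E_{4k}(2k)| + 8k/r² for r ≤ k/2.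

For uniformity, the leading term can be of bounded size near n/6, but not smaller, because 6ν - n is
a nonzero integer. There the error is o(1); near the ends it is O(n), against a leading term of
order n log n. -/

/-- The error of the leading term of the cosecant sum. -/
noncomputable def cosecantError (n ν : ℕ) : ℝ := cosecantSum n ν - leadingTerm n ν

/-! ### Difference, reflection and duplication identities -/

theorem two_mul_sin_half_mul_sum_sin (θ : ℝ) (n : ℕ) (hn : 1 ≤ n) :
    2 * sin (θ / 2) * ∑ l ∈ Ico 1 n, sin (l * θ) = cos (θ / 2) - cos (n * θ - θ / 2) := by
  induction n, hn using Nat.le_induction with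
  | base => simp; ring_nf
  | succ n hn ih =>
    rw [sum_Ico_succ_top hn, mul_add, ih]
    have h1 : cos (n * θ - θ / 2) = cos (n * θ) * cos (θ / 2) + sin (n * θ) * sin (θ / 2) :=
      cos_sub _ _
    have h2 : cos ((n + 1 : ℕ) * θ - θ / 2)
        = cos (n * θ) * cos (θ / 2) - sin (n * θ) * sin (θ / 2) := by
      rw [← cos_add]; push_cast; ring_nf
    rw [h1, h2]; ring

/-- The difference of the two cosines is -2 sin(lθ) sin(πl/n), whose second factor cancels the
cosecant; what remains is a sum of sines with nθ an odd multiple of π. -/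
theorem cosecantSum_succ_sub (n ν : ℕ) (h : ν < n) :
    cosecantSum n (ν + 1) - cosecantSum n ν
      = -2 * (cos ((2 * ν + 1) * π / (2 * n)) / sin ((2 * ν + 1) * π / (2 * n))) := by
  have hn : (0 : ℝ) < n := by exact_mod_cast (by omega : 0 < n)
  have hν : (ν : ℝ) + 1 ≤ n := by exact_mod_cast h
  set θ : ℝ := (2 * ν + 1) * π / n with hθ
  have hθ2 : (2 * ν + 1) * π / (2 * n) = θ / 2 := by rw [hθ]; field_simp
  have hs : 0 < sin (θ / 2) := by
    rw [← hθ2]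
    apply sin_pos_of_pos_of_lt_pi
    · positivity
    · rw [div_lt_iff₀ (by positivity)]; nlinarith [pi_pos]
  have hsum := two_mul_sin_half_mul_sum_sin θ n (by omega)
  have hc : cos (n * θ - θ / 2) = -cos (θ / 2) := by
    have : (n : ℝ) * θ - θ / 2 = (π - θ / 2) + ν * (2 * π) := by
      rw [hθ]; field_simp; ring
    rw [this, cos_add_nat_mul_two_pi, cos_pi_sub]
  rw [hc] at hsum
  rw [hθ2]
  have key : cosecantSum n (ν + 1) - cosecantSum n ν = -2 * ∑ l ∈ Ico 1 n, sin (l * θ) := by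
    rw [cosecantSum, cosecantSum, ← sum_sub_distrib, mul_sum]
    apply sum_congr rfl
    intro l hl
    rw [mem_Ico] at hl
    have hl1 : (1 : ℝ) ≤ l := by exact_mod_cast hl.1
    have hl2 : (l : ℝ) < n := by exact_mod_cast hl.2
    have hsl : 0 < sin (π * l / n) := by
      apply sin_pos_of_pos_of_lt_pi
      · positivity
      · rw [div_lt_iff₀ hn]; nlinarith [pi_pos]
    have e1 : 2 * π * ((ν + 1 : ℕ) : ℝ) * l / n = l * θ + π * l / n := by
      rw [hθ]; push_cast; field_simp; ring
    have e2 : 2 * π * (ν : ℝ) * l / n = l * θ - π * l / n := by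
      rw [hθ]; field_simp; ring
    rw [e1, e2, cos_add, cos_sub]
    generalize π * (l : ℝ) / n = y at *
    field_simp
    ring
  rw [key]
  field_simp
  linarith

theorem cosecantSum_reflect (n ν : ℕ) (h : ν ≤ n) (hn : 1 ≤ n) :
    cosecantSum n (n - ν) = cosecantSum n ν := by
  have hn : (0 : ℝ) < n := by exact_mod_cast hn
  apply sum_congr rfl
  intro l _
  congr 1
  have : 2 * π * ((n - ν : ℕ) : ℝ) * l / n = l * (2 * π) - 2 * π * ν * l / n := by
    rw [Nat.cast_sub h]; field_simp
  rw [this, cos_nat_mul_two_pi_sub]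

theorem leadingTerm_reflect (n ν : ℕ) (h : ν ≤ n) (hn : 1 ≤ n) :
    leadingTerm n (n - ν) = leadingTerm n ν := by
  have hn : (0 : ℝ) < n := by exact_mod_cast hn
  have : π * ((n - ν : ℕ) : ℝ) / n = π - π * ν / n := by
    rw [Nat.cast_sub h]; field_simp
  rw [leadingTerm, this, sin_pi_sub, leadingTerm]

theorem cosecantError_reflect (n ν : ℕ) (h : ν ≤ n) (hn : 1 ≤ n) :
    cosecantError n (n - ν) = cosecantError n ν := by
  rw [cosecantError, cosecantSum_reflect n ν h hn, leadingTerm_reflect n ν h hn, cosecantError]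

theorem sum_Ico_one_two_mul_of_odd_eq_zero (g : ℕ → ℝ) (hg : ∀ l, g (2 * l + 1) = 0) (k : ℕ) :
    ∑ l ∈ Ico 1 (2 * k), g l = ∑ l ∈ Ico 1 k, g (2 * l) := by
  rcases Nat.eq_zero_or_pos k with rfl | hk
  · simp
  induction k, hk using Nat.le_induction with
  | base => simpa using hg 0
  | succ k hk ih =>
    rw [show 2 * (k + 1) = 2 * k + 1 + 1 by ring, sum_Ico_succ_top (by omega),
      sum_Ico_succ_top (by omega), ih, sum_Ico_succ_top hk, hg, add_zero]

/-- Shifting r by k multiplies the l-th cosine by (-1)^l, so only even l survive. -/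
theorem cosecantSum_double (k r : ℕ) (hk : 1 ≤ k) :
    cosecantSum (2 * k) r + cosecantSum (2 * k) (r + k) = 2 * cosecantSum k r := by
  have hk : (0 : ℝ) < k := by exact_mod_cast hk
  rw [cosecantSum, cosecantSum, ← sum_add_distrib]
  have e (l : ℕ) : 2 * π * ((r + k : ℕ) : ℝ) * l / (2 * k : ℕ)
      = 2 * π * r * l / (2 * k : ℕ) + l * π := by
    push_cast; field_simp
  simp_rw [e, cos_add_nat_mul_pi]
  rw [sum_Ico_one_two_mul_of_odd_eq_zero]
  · rw [cosecantSum, mul_sum]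
    apply sum_congr rfl
    intro l _
    rw [pow_mul, neg_one_sq, one_pow]
    have e1 : 2 * π * r * ((2 * l : ℕ) : ℝ) / (2 * k : ℕ) = 2 * π * r * l / k := by
      push_cast; field_simp
    have e2 : π * ((2 * l : ℕ) : ℝ) / (2 * k : ℕ) = π * l / k := by
      push_cast; field_simp
    rw [e1, e2]; ring
  · intro l
    rw [pow_succ, pow_mul, neg_one_sq, one_pow]; ring

theorem sin_pi_mul_div_pos (n ν : ℕ) (h1 : 1 ≤ ν) (h2 : ν < n) : 0 < sin (π * ν / n) := by
  have h1' : (1 : ℝ) ≤ ν := by exact_mod_cast h1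
  have h2' : (ν : ℝ) < n := by exact_mod_cast h2
  have hn : (0 : ℝ) < n := by linarith
  apply sin_pos_of_pos_of_lt_pi
  · positivity
  · rw [div_lt_iff₀ hn]; nlinarith [pi_pos]

theorem leadingTerm_double (k r : ℕ) (h1 : 1 ≤ r) (h2 : r < k) :
    leadingTerm (2 * k) r + leadingTerm (2 * k) (r + k) = 2 * leadingTerm k r := by
  have hk : (0 : ℝ) < k := by exact_mod_cast (by omega : 0 < k)
  have p1 := sin_pi_mul_div_pos (2 * k) r h1 (by omega)
  have p2 := sin_pi_mul_div_pos (2 * k) (r + k) (by omega) (by omega)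
  have e : π * ((r + k : ℕ) : ℝ) / (2 * k : ℕ) = π * r / (2 * k : ℕ) + π / 2 := by
    push_cast; field_simp
  have e2 : π * (r : ℝ) / k = 2 * (π * r / (2 * k : ℕ)) := by
    push_cast; field_simp
  have : log (2 * sin (π * r / k)) = log (2 * sin (π * r / (2 * k : ℕ)))
      + log (2 * sin (π * ((r + k : ℕ) : ℝ) / (2 * k : ℕ))) := by
    rw [← log_mul (by positivity) (by positivity), e, sin_add_pi_div_two, e2, sin_two_mul]
    ring_nf
  rw [leadingTerm, leadingTerm, leadingTerm, this]
  push_cast; ring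

theorem cosecantError_double (k r : ℕ) (h1 : 1 ≤ r) (h2 : r < k) :
    cosecantError (2 * k) r + cosecantError (2 * k) (r + k) = 2 * cosecantError k r := by
  have a := cosecantSum_double k r (by omega)
  have b := leadingTerm_double k r h1 h2
  simp only [cosecantError]; linarith

/-! ### Midpoint rule for the cotangent and monotonicity of the error -/

theorem hasDerivAt_log_sin_diff (c t : ℝ) (hp : 0 < sin (c + t)) (hm : 0 < sin (c - t)) :
    HasDerivAt (fun t => log (sin (c + t)) - log (sin (c - t)) - 2 * t * (cos c / sin c))
      (cos (c + t) / sin (c + t) + cos (c - t) / sin (c - t) - 2 * (cos c / sin c)) t := by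
  have h1 : HasDerivAt (fun t => log (sin (c + t))) (cos (c + t) / sin (c + t)) t := by
    have := (((hasDerivAt_id t).const_add c).sin).log hp.ne'
    simpa using this
  have h2 : HasDerivAt (fun t => log (sin (c - t))) (-cos (c - t) / sin (c - t)) t := by
    have := (((hasDerivAt_id t).const_sub c).sin).log hm.ne'
    simpa using this
  have h3 : HasDerivAt (fun t => 2 * t * (cos c / sin c)) (2 * (cos c / sin c)) t := by
    have := ((hasDerivAt_id t).const_mul 2).mul_const (cos c / sin c)
    simpa using this
  exact ((h1.sub h2).sub h3).congr_deriv (by ring)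

theorem cot_add_cot_sub_two_cot (c t : ℝ) (hc : 0 < sin c) (hp : 0 < sin (c + t))
    (hm : 0 < sin (c - t)) :
    cos (c + t) / sin (c + t) + cos (c - t) / sin (c - t) - 2 * (cos c / sin c)
      = 2 * cos c * sin t ^ 2 / (sin c * sin (c + t) * sin (c - t)) := by
  have hpm : sin (c + t) * sin (c - t) = sin c ^ 2 - sin t ^ 2 := by
    rw [sin_add, sin_sub]
    linear_combination sin c ^ 2 * (sin_sq_add_cos_sq t) - sin t ^ 2 * (sin_sq_add_cos_sq c)
  have hsum : cos (c + t) * sin (c - t) + cos (c - t) * sin (c + t) = 2 * sin c * cos c := by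
    rw [sin_add, sin_sub, cos_add, cos_sub]
    linear_combination 2 * sin c * cos c * (sin_sq_add_cos_sq t)
  field_simp
  linear_combination sin c * hsum - 2 * cos c * hpm

/-- The midpoint rule for the cotangent, with an upper bound for its error. -/
theorem midpoint_cot (a s : ℝ) (ha : 0 < a) (hs : 0 < s) (h : a + 2 * s ≤ π / 2) :
    0 < log (sin (a + 2 * s)) - log (sin a) - 2 * s * (cos (a + s) / sin (a + s)) ∧
    log (sin (a + 2 * s)) - log (sin a) - 2 * s * (cos (a + s) / sin (a + s))
      ≤ 2 * s ^ 2 / (2 / π * a) ^ 3 * s := by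
  set c := a + s with hc
  have e1 : a + 2 * s = c + s := by rw [hc]; ring
  have e2 : a = c - s := by rw [hc]; ring
  -- φ t is the midpoint-rule error on [c - t, c + t]. Its derivative is a symmetric second
  -- difference of cot, positive by the closed form above; the mean value theorem on [0, s] gives
  -- both bounds, with Jordan's inequality bounding the sines below.
  set φ : ℝ → ℝ := fun t => log (sin (c + t)) - log (sin (c - t)) - 2 * t * (cos c / sin c)
    with hφ
  have low (x : ℝ) (h1 : a ≤ x) (h2 : x ≤ π / 2) : 2 / π * a ≤ sin x :=
    (mul_le_mul_of_nonneg_left h1 (by positivity)).trans (mul_le_sin (by linarith) h2)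
  have hq : 0 < 2 / π * a := by positivity
  have pos (x : ℝ) (h1 : a ≤ x) (h2 : x ≤ π / 2) : 0 < sin x := hq.trans_le (low x h1 h2)
  have hd (t : ℝ) (ht : t ∈ Set.Icc 0 s) : HasDerivAt φ
      (2 * cos c * sin t ^ 2 / (sin c * sin (c + t) * sin (c - t))) t := by
    have p1 := pos (c + t) (by linarith [ht.1]) (by linarith [ht.2])
    have p2 := pos (c - t) (by linarith [ht.2]) (by linarith [ht.1])
    rw [← cot_add_cot_sub_two_cot c t (pos c (by linarith) (by linarith)) p1 p2]
    exact hasDerivAt_log_sin_diff c t p1 p2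
  have hcont : ContinuousOn φ (Set.Icc 0 s) := fun t ht => (hd t ht).continuousAt.continuousWithinAt
  obtain ⟨t, ht, hts⟩ := exists_hasDerivAt_eq_slope φ _ hs hcont
    (fun t ht => hd t ⟨ht.1.le, ht.2.le⟩)
  have h0 : φ 0 = 0 := by simp [hφ]
  have hφs : φ s = log (sin (a + 2 * s)) - log (sin a) - 2 * s * (cos c / sin c) := by
    rw [hφ, e1]; simp only; rw [← e2]
  rw [h0, sub_zero, sub_zero, eq_div_iff hs.ne', hφs] at hts
  rw [← hts]
  have q1 := low c (by linarith) (by linarith)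
  have q2 := low (c + t) (by linarith [ht.1]) (by linarith [ht.2])
  have q3 := low (c - t) (by linarith [ht.2]) (by linarith [ht.1])
  have hcos : 0 < cos c := cos_pos_of_mem_Ioo ⟨by linarith, by linarith⟩
  have hsint : 0 < sin t := sin_pos_of_pos_of_lt_pi ht.1 (by linarith [ht.2, pi_pos])
  have hsint2 : sin t ≤ s := (sin_lt ht.1).le.trans ht.2.le
  have p1 := hq.trans_le q1
  have p2 := hq.trans_le q2
  have p3 := hq.trans_le q3
  refine ⟨by positivity, ?_⟩
  apply mul_le_mul_of_nonneg_right _ hs.le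
  apply div_le_div₀ (by positivity) _ (by positivity)
  · calc (2 / π * a) ^ 3 = (2 / π * a) * (2 / π * a) * (2 / π * a) := by ring
      _ ≤ _ := by gcongr
  · have : sin t ^ 2 ≤ s ^ 2 := by gcongr
    nlinarith [cos_le_one c, sq_nonneg (sin t)]

theorem cosecantError_succ (n ν : ℕ) (h1 : 1 ≤ ν) (h2 : 2 * (ν + 1) ≤ n) :
    cosecantError n ν < cosecantError n (ν + 1) ∧
      cosecantError n (ν + 1) ≤ cosecantError n ν + n / (ν : ℝ) ^ 3 := by
  have hν : (1 : ℝ) ≤ ν := by exact_mod_cast h1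
  have hn2 : 2 * ((ν : ℝ) + 1) ≤ n := by exact_mod_cast h2
  have hn : (0 : ℝ) < n := by linarith
  have hpi := pi_pos
  have hm := midpoint_cot (π * ν / n) (π / (2 * n)) (by positivity) (by positivity) (by
    rw [show π * ν / n + 2 * (π / (2 * n)) = π * (2 * (ν + 1)) / (2 * n) by field_simp,
      div_le_div_iff₀ (by positivity) (by positivity)]
    nlinarith)
  have e1 : π * ν / n + 2 * (π / (2 * n)) = π * ((ν + 1 : ℕ) : ℝ) / n := by
    push_cast; field_simp
  have e2 : π * ν / n + π / (2 * n) = (2 * ν + 1) * π / (2 * n) := by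
    field_simp
  have e3 : 2 * (π / (2 * n)) ^ 2 / (2 / π * (π * ν / n)) ^ 3 * (π / (2 * n))
      = π ^ 3 / (32 * (ν : ℝ) ^ 3) := by
    field_simp; norm_num
  rw [e1, e2, e3] at hm
  have s1 := sin_pi_mul_div_pos n ν h1 (by omega)
  have s2 := sin_pi_mul_div_pos n (ν + 1) (by omega) (by omega)
  have hC := cosecantSum_succ_sub n ν (by omega)
  set δ := log (sin (π * ((ν + 1 : ℕ) : ℝ) / n)) - log (sin (π * ν / n))
    - 2 * (π / (2 * n)) * (cos ((2 * ν + 1) * π / (2 * n)) / sin ((2 * ν + 1) * π / (2 * n)))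
    with hδ
  have key : cosecantError n (ν + 1) - cosecantError n ν = 2 * n / π * δ := by
    have : cosecantError n (ν + 1) - cosecantError n ν
      = (cosecantSum n (ν + 1) - cosecantSum n ν)
        - (leadingTerm n (ν + 1) - leadingTerm n ν) := by simp only [cosecantError]; ring
    rw [this, hC, leadingTerm, leadingTerm, log_mul two_ne_zero s1.ne',
      log_mul two_ne_zero s2.ne', hδ]
    field_simp
    ring
  have hpos : 0 < 2 * n / π * δ := mul_pos (by positivity) hm.1
  have hle : 2 * n / π * δ ≤ n / (ν : ℝ) ^ 3 := by
    calc 2 * n / π * δ ≤ 2 * n / π * (π ^ 3 / (32 * (ν : ℝ) ^ 3)) := by gcongr; exact hm.2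
      _ = π ^ 2 / 16 * (n / (ν : ℝ) ^ 3) := by field_simp; norm_num
      _ ≤ 1 * (n / (ν : ℝ) ^ 3) := by
        gcongr
        nlinarith [pi_lt_four]
      _ = _ := one_mul _
  exact ⟨by linarith, by linarith⟩

theorem cosecantError_lt_of_lt (n μ ν : ℕ) (h1 : 1 ≤ μ) (h2 : 2 * ν ≤ n) (h : μ < ν) :
    cosecantError n μ < cosecantError n ν := by
  induction ν, h using Nat.le_induction with
  | base => exact (cosecantError_succ n μ h1 (by omega)).1
  | succ ν hν ih => exact (ih (by omega)).trans (cosecantError_succ n ν (by omega) h2).1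

/-- The increments n/ν³ are dominated by the telescoping differences of 2n/ν². -/
theorem cosecantError_le_add (n μ ν : ℕ) (h1 : 1 ≤ μ) (h2 : 2 * ν ≤ n) (h : μ ≤ ν) :
    cosecantError n ν ≤ cosecantError n μ + 2 * n / (μ : ℝ) ^ 2 - 2 * n / (ν : ℝ) ^ 2 := by
  induction ν, h using Nat.le_induction with
  | base => linarith
  | succ ν hν ih =>
    have a := ih (by omega)
    have b := (cosecantError_succ n ν (by omega) h2).2
    have hν1 : (1 : ℝ) ≤ ν := by exact_mod_cast (by omega : 1 ≤ ν)
    have : (n : ℝ) / (ν : ℝ) ^ 3 ≤ 2 * n / (ν : ℝ) ^ 2 - 2 * n / ((ν + 1 : ℕ) : ℝ) ^ 2 := by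
      have : 2 * n / (ν : ℝ) ^ 2 - 2 * n / ((ν + 1 : ℕ) : ℝ) ^ 2 - (n : ℝ) / (ν : ℝ) ^ 3
          = n * (3 * ν ^ 2 - 1) / ((ν : ℝ) ^ 3 * (ν + 1) ^ 2) := by
        push_cast; field_simp; ring
      have h3 : 0 ≤ n * (3 * (ν : ℝ) ^ 2 - 1) / ((ν : ℝ) ^ 3 * (ν + 1) ^ 2) := by
        apply div_nonneg _ (by positivity)
        apply mul_nonneg (by positivity)
        nlinarith
      linarith
    linarith

/-! ### The regular part of the cosecant -/

theorem AnalyticAt.dslope_same {f : ℝ → ℝ} {a : ℝ} (h : AnalyticAt ℝ f a) :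
    AnalyticAt ℝ (dslope f a) a := by
  obtain ⟨p, hp⟩ := h
  exact ⟨_, hp.has_fpower_series_dslope_fslope⟩

theorem AnalyticAt.dslope {f : ℝ → ℝ} {a b : ℝ} (ha : AnalyticAt ℝ f a) (hb : AnalyticAt ℝ f b) :
    AnalyticAt ℝ (dslope f a) b := by
  rcases eq_or_ne b a with rfl | hne
  · exact ha.dslope_same
  · have h : AnalyticAt ℝ (fun x => (x - a)⁻¹ * (f x - f a)) b :=
      ((analyticAt_id.sub analyticAt_const).inv (sub_ne_zero.2 hne)).mul
        (hb.sub analyticAt_const)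
    refine h.congr ?_
    filter_upwards [dslope_eventuallyEq_slope_of_ne f hne] with x hx
    rw [hx, slope_def_field, div_eq_inv_mul]

/-- The analytic continuation of `csc x - 1 / x` to `(-π, π)`. -/
noncomputable def cscRegular : ℝ → ℝ := dslope (fun x => (dslope sin 0 x)⁻¹) 0

theorem dslope_sin_zero_ne_zero (x : ℝ) (h0 : 0 ≤ x) (h1 : x < π) : dslope sin 0 x ≠ 0 := by
  rcases h0.eq_or_lt with rfl | h0
  · simp [_root_.dslope_same]
  · rw [dslope_of_ne _ h0.ne', slope_def_field]
    have := sin_pos_of_pos_of_lt_pi h0 h1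
    simp only [sin_zero, sub_zero]
    positivity

theorem analyticAt_cscRegular (x : ℝ) (h0 : 0 ≤ x) (h1 : x < π) : AnalyticAt ℝ cscRegular x := by
  have key (y : ℝ) (h0 : 0 ≤ y) (h1 : y < π) : AnalyticAt ℝ (fun x => (dslope sin 0 x)⁻¹) y :=
    (analyticAt_sin.dslope analyticAt_sin).inv (dslope_sin_zero_ne_zero y h0 h1)
  exact (key 0 le_rfl pi_pos).dslope (key x h0 h1)

theorem one_div_sin_eq_add_cscRegular (x : ℝ) (h0 : 0 < x) (h1 : x < π) :
    1 / sin x = 1 / x + cscRegular x := by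
  have := sin_pos_of_pos_of_lt_pi h0 h1
  rw [cscRegular, dslope_of_ne _ h0.ne', slope_def_field, _root_.dslope_same,
    dslope_of_ne _ h0.ne', slope_def_field]
  simp
  field_simp
  ring

/-- Second differences of an analytic function are quadratically small. -/
theorem exists_second_difference_le {f : ℝ → ℝ} {a b : ℝ}
    (hf : ∀ x ∈ Set.Icc a b, AnalyticAt ℝ f x) :
    ∃ M, 0 ≤ M ∧ ∀ x h, 0 ≤ h → a ≤ x - h → x + h ≤ b →
      |f (x - h) - 2 * f x + f (x + h)| ≤ M * h ^ 2 := by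
  have hcont : ContinuousOn (deriv (deriv f)) (Set.Icc a b) :=
    fun x hx => (hf x hx).deriv.deriv.continuousAt.continuousWithinAt
  obtain ⟨C, hC⟩ := isCompact_Icc.exists_bound_of_continuousOn hcont
  have hlip (u v : ℝ) (hu : u ∈ Set.Icc a b) (hv : v ∈ Set.Icc a b) :
      ‖deriv f v - deriv f u‖ ≤ C * ‖v - u‖ :=
    (convex_Icc a b).norm_image_sub_le_of_norm_deriv_le
      (fun x hx => (hf x hx).deriv.differentiableAt) hC hu hv
  refine ⟨2 * |C|, by positivity, fun x h h0 ha hb => ?_⟩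
  have hd (t : ℝ) (ht : t ∈ Set.Icc 0 h) :
      HasDerivAt (fun t => f (x - t) + f (x + t)) (-deriv f (x - t) + deriv f (x + t)) t := by
    have m1 : x - t ∈ Set.Icc a b := ⟨by linarith [ht.2], by linarith [ht.1]⟩
    have m2 : x + t ∈ Set.Icc a b := ⟨by linarith [ht.1], by linarith [ht.2]⟩
    exact ((hf _ m1).differentiableAt.hasDerivAt.comp_const_sub x t).add
      ((hf _ m2).differentiableAt.hasDerivAt.comp_const_add x t)
  have := norm_image_sub_le_of_norm_deriv_le_segment' (C := 2 * |C| * h)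
    (fun t ht => (hd t ht).hasDerivWithinAt) (fun t ht => by
      have m1 : x - t ∈ Set.Icc a b := ⟨by linarith [ht.2], by linarith [ht.1]⟩
      have m2 : x + t ∈ Set.Icc a b := ⟨by linarith [ht.1], by linarith [ht.2]⟩
      have := hlip _ _ m1 m2
      rw [show x + t - (x - t) = 2 * t by ring, norm_of_nonneg (show 0 ≤ 2 * t by linarith [ht.1])] at this
      rw [neg_add_eq_sub]
      calc _ ≤ C * (2 * t) := this
        _ ≤ |C| * (2 * h) := by
          apply mul_le_mul (le_abs_self C) (by linarith [ht.2]) (by linarith [ht.1]) (abs_nonneg C)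
        _ = _ := by ring) h ⟨h0, le_rfl⟩
  rw [norm_eq_abs] at this
  simp only [sub_zero, add_zero] at this
  calc _ = |f (x - h) + f (x + h) - (f x + f x)| := by ring_nf
    _ ≤ _ := this
    _ = _ := by ring

/-! ### Alternating sums: the regular part and the harmonic part -/

theorem two_mul_alternating_sum (g : ℕ → ℝ) (k : ℕ) :
    2 * ∑ l ∈ Icc 1 (2 * k), (-1 : ℝ) ^ l * g l
      = ∑ j ∈ range k, (g (2 * j) - 2 * g (2 * j + 1) + g (2 * j + 2)) + g (2 * k) - g 0 := by
  induction k with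
  | zero => simp
  | succ k ih =>
    rw [show 2 * (k + 1) = 2 * k + 1 + 1 by ring, sum_Icc_succ_top (by omega),
      sum_Icc_succ_top (by omega), sum_range_succ]
    have e1 : (-1 : ℝ) ^ (2 * k + 1) = -1 := by rw [pow_succ, pow_mul]; simp
    have e2 : (-1 : ℝ) ^ (2 * k + 1 + 1) = 1 := by rw [pow_succ, e1]; simp
    rw [e1, e2]
    linarith

/-- Pairing terms leaves k second differences of size O(k⁻²), which vanish in the limit, and the
boundary values of `cscRegular` at π/2 and 0. -/
theorem tendsto_alternating_sum_cscRegular :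
    Tendsto (fun k : ℕ => 2 * ∑ l ∈ Icc 1 (2 * k),
      (-1 : ℝ) ^ l * cscRegular (π * l / (4 * k : ℕ))) atTop (𝓝 (1 - 2 / π)) := by
  have hpi := pi_pos
  obtain ⟨M, hM0, hM⟩ := exists_second_difference_le (f := cscRegular) (a := 0) (b := π / 2)
    (fun x hx => analyticAt_cscRegular x hx.1 (by linarith [hx.2]))
  have hend : cscRegular (π / 2) = 1 - 2 / π := by
    have := one_div_sin_eq_add_cscRegular (π / 2) (by positivity) (by linarith)
    rw [sin_pi_div_two] at this
    have e : 1 / (π / 2) = 2 / π := by field_simp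
    linarith
  have h0 : cscRegular 0 = 0 := by
    -- x / sin x is even, so its derivative at 0 vanishes.
    have hs : deriv (fun x => (dslope sin 0 x)⁻¹) 0 = 0 := by
      have heven : ∀ x, (dslope sin 0 (-x))⁻¹ = (dslope sin 0 x)⁻¹ := by
        intro x
        rcases eq_or_ne x 0 with rfl | hx
        · simp
        · rw [dslope_of_ne _ hx, dslope_of_ne _ (neg_ne_zero.2 hx), slope_def_field,
            slope_def_field]
          simp
      have := deriv_comp_neg (fun x => (dslope sin 0 x)⁻¹) 0
      simp only [heven, neg_zero] at this
      linarith
    rw [cscRegular, _root_.dslope_same, hs]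
  rw [← hend, tendsto_iff_norm_sub_tendsto_zero]
  have hlim : Tendsto (fun k : ℕ => M * π ^ 2 / 16 * (1 / (k : ℝ))) atTop (𝓝 0) := by
    have := (tendsto_one_div_atTop_nhds_zero_nat (𝕜 := ℝ)).const_mul (M * π ^ 2 / 16)
    rwa [mul_zero] at this
  refine squeeze_zero' (Eventually.of_forall fun k => norm_nonneg _) ?_ hlim
  filter_upwards [eventually_ge_atTop 1] with k hk
  have hk' : (1 : ℝ) ≤ k := by exact_mod_cast hk
  rw [two_mul_alternating_sum (fun l => cscRegular (π * l / (4 * k : ℕ)))]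
  have e1 : π * ((2 * k : ℕ) : ℝ) / (4 * k : ℕ) = π / 2 := by push_cast; field_simp; norm_num
  rw [e1]
  simp only [Nat.cast_zero, mul_zero, zero_div, h0, sub_zero, add_sub_cancel_right]
  refine (norm_sum_le _ _).trans ?_
  have hb : ∀ j ∈ range k, ‖cscRegular (π * ((2 * j : ℕ) : ℝ) / (4 * k : ℕ))
      - 2 * cscRegular (π * ((2 * j + 1 : ℕ) : ℝ) / (4 * k : ℕ))
      + cscRegular (π * ((2 * j + 2 : ℕ) : ℝ) / (4 * k : ℕ))‖ ≤ M * (π / (4 * k)) ^ 2 := by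
    intro j hj
    have hj' : (j : ℝ) + 1 ≤ k := by exact_mod_cast mem_range.1 hj
    have := hM (π * ((2 * j + 1 : ℕ) : ℝ) / (4 * k : ℕ)) (π / (4 * k)) (by positivity)
      (by
        have : π * ((2 * j + 1 : ℕ) : ℝ) / (4 * k : ℕ) - π / (4 * k) = π * j / (2 * k) := by
          push_cast; field_simp; ring
        rw [this]; positivity)
      (by
        have : π * ((2 * j + 1 : ℕ) : ℝ) / (4 * k : ℕ) + π / (4 * k)
            = π * (j + 1) / (2 * k) := by
          push_cast; field_simp; ring
        rw [this, div_le_div_iff₀ (by positivity) (by positivity)]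
        nlinarith)
    rw [norm_eq_abs]
    convert this using 5
    · push_cast; field_simp; ring
    · push_cast; field_simp; ring
  refine (sum_le_sum hb).trans (le_of_eq ?_)
  rw [sum_const, card_range, nsmul_eq_mul]
  field_simp
  norm_num

theorem sum_alternating_eq_harmonic_sub (k : ℕ) :
    ∑ l ∈ Icc 1 (2 * k), (-1 : ℝ) ^ l * (1 / (l : ℝ))
      = ((harmonic k : ℚ) : ℝ) - ((harmonic (2 * k) : ℚ) : ℝ) := by
  induction k with
  | zero => simp
  | succ k ih =>
    rw [show 2 * (k + 1) = 2 * k + 1 + 1 by ring, sum_Icc_succ_top (by omega),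
      sum_Icc_succ_top (by omega), ih, harmonic_succ, harmonic_succ, harmonic_succ]
    have e1 : (-1 : ℝ) ^ (2 * k + 1) = -1 := by rw [pow_succ, pow_mul]; simp
    have e2 : (-1 : ℝ) ^ (2 * k + 1 + 1) = 1 := by rw [pow_succ, e1]; simp
    rw [e1, e2]
    push_cast
    field_simp
    ring

/-- The remainder of the alternating harmonic series after `2k` terms. -/
noncomputable def altHarmonicTail (k : ℕ) : ℝ :=
  log 2 + ∑ l ∈ Icc 1 (2 * k), (-1 : ℝ) ^ l * (1 / (l : ℝ))

theorem tendsto_altHarmonicTail : Tendsto altHarmonicTail atTop (𝓝 0) := by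
  have h1 := tendsto_harmonic_sub_log
  have h2 : Tendsto (fun k : ℕ => 2 * k) atTop atTop :=
    tendsto_id.const_mul_atTop' (by norm_num)
  have h3 := h1.sub (h1.comp h2)
  rw [sub_self] at h3
  refine h3.congr' ?_
  filter_upwards [eventually_ge_atTop 1] with k hk
  have hk' : (0 : ℝ) < k := by exact_mod_cast hk
  rw [altHarmonicTail, sum_alternating_eq_harmonic_sub]
  simp only [Function.comp]
  push_cast
  rw [log_mul two_ne_zero hk'.ne']
  ring

theorem altHarmonicTail_succ (k : ℕ) :
    altHarmonicTail (k + 1) = altHarmonicTail k - 1 / ((2 * k + 1) * (2 * k + 2)) := by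
  rw [altHarmonicTail, altHarmonicTail, show 2 * (k + 1) = 2 * k + 1 + 1 by ring,
    sum_Icc_succ_top (by omega), sum_Icc_succ_top (by omega)]
  have e1 : (-1 : ℝ) ^ (2 * k + 1) = -1 := by rw [pow_succ, pow_mul]; simp
  have e2 : (-1 : ℝ) ^ (2 * k + 1 + 1) = 1 := by rw [pow_succ, e1]; simp
  rw [e1, e2]
  push_cast
  field_simp
  ring

/-- Both gaps between the tail and its bounds decrease to 0, hence are nonnegative. -/
theorem altHarmonicTail_bounds (k : ℕ) (hk : 1 ≤ k) :
    1 / (4 * k + 2) ≤ altHarmonicTail k ∧ altHarmonicTail k ≤ 1 / (4 * k) := by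
  have l1 : Tendsto (fun k : ℕ => (1 : ℝ) / (4 * k + 2)) atTop (𝓝 0) := by
    simp only [one_div]
    refine tendsto_inv_atTop_zero.comp (tendsto_atTop_add_const_right _ _ ?_)
    exact tendsto_natCast_atTop_atTop.const_mul_atTop (by norm_num)
  have l2 : Tendsto (fun k : ℕ => (1 : ℝ) / (4 * k)) atTop (𝓝 0) := by
    simp only [one_div]
    exact tendsto_inv_atTop_zero.comp
      (tendsto_natCast_atTop_atTop.const_mul_atTop (by norm_num))
  have t1 := tendsto_altHarmonicTail.sub l1
  have t2 := l2.sub tendsto_altHarmonicTail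
  rw [sub_zero] at t1 t2
  have a1 : Antitone fun k : ℕ => altHarmonicTail k - (1 : ℝ) / (4 * k + 2) := by
    refine antitone_nat_of_succ_le fun k => ?_
    rw [altHarmonicTail_succ, ← sub_nonneg]
    have : altHarmonicTail k - 1 / (4 * (k : ℝ) + 2) - (altHarmonicTail k
        - 1 / ((2 * k + 1) * (2 * k + 2)) - 1 / (4 * ((k + 1 : ℕ) : ℝ) + 2))
        = 1 / ((2 * k + 1) * (2 * k + 2) * (2 * k + 3)) := by
      push_cast; field_simp; ring
    rw [this]; positivity
  -- The index starts at k ≥ 1 because 1 / (4 * 0) is 0 by convention, which would break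
  -- monotonicity.
  have a2 : Antitone fun i : ℕ => 1 / (4 * (k + i : ℕ) : ℝ) - altHarmonicTail (k + i) := by
    refine antitone_nat_of_succ_le fun i => ?_
    rw [← add_assoc, altHarmonicTail_succ, ← sub_nonneg]
    have hk' : (1 : ℝ) ≤ (k + i : ℕ) := by exact_mod_cast (by omega : 1 ≤ k + i)
    generalize k + i = j at *
    have : 1 / (4 * (j : ℝ)) - altHarmonicTail j - (1 / (4 * ((j + 1 : ℕ) : ℝ))
        - (altHarmonicTail j - 1 / ((2 * j + 1) * (2 * j + 2))))
        = 1 / (4 * j * (j + 1) * (2 * j + 1)) := by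
      push_cast; field_simp; ring
    rw [this]; positivity
  constructor
  · exact sub_nonneg.1 (a1.le_of_tendsto t1 k)
  · refine sub_nonneg.1 (a2.le_of_tendsto ?_ 0)
    refine (t2.comp (tendsto_add_atTop_nat k)).congr fun i => ?_
    simp only [Function.comp]
    rw [add_comm]

theorem tendsto_mul_altHarmonicTail :
    Tendsto (fun k : ℕ => 8 * k / π * altHarmonicTail k) atTop (𝓝 (2 / π)) := by
  have hpi := pi_pos
  have l : Tendsto (fun k : ℕ => 2 / π - 2 / π * (1 / (k : ℝ))) atTop (𝓝 (2 / π)) := by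
    simpa using (tendsto_one_div_atTop_nhds_zero_nat.const_mul (2 / π)).const_sub (2 / π)
  refine tendsto_of_tendsto_of_tendsto_of_le_of_le' l tendsto_const_nhds ?_ ?_
  · filter_upwards [eventually_ge_atTop 1] with k hk
    have hk' : (0 : ℝ) < k := by exact_mod_cast hk
    calc 2 / π - 2 / π * (1 / (k : ℝ)) ≤ 8 * k / π * (1 / (4 * k + 2)) := by
          rw [← sub_nonneg]
          have : 8 * k / π * (1 / (4 * k + 2)) - (2 / π - 2 / π * (1 / (k : ℝ)))
            = 2 * (k + 1) / (π * k * (2 * k + 1)) := by field_simp; ring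
          rw [this]; positivity
      _ ≤ _ := by gcongr; exact (altHarmonicTail_bounds k hk).1
  · filter_upwards [eventually_ge_atTop 1] with k hk
    have hk' : (0 : ℝ) < k := by exact_mod_cast hk
    calc _ ≤ 8 * k / π * (1 / (4 * k)) := by gcongr; exact (altHarmonicTail_bounds k hk).2
      _ = _ := by field_simp; norm_num

/-! ### The error at the centre -/

theorem cosecantSum_center (k : ℕ) (hk : 1 ≤ k) :
    cosecantSum (4 * k) (2 * k)
      = 2 * ∑ l ∈ Icc 1 (2 * k), (-1 : ℝ) ^ l * (1 / sin (π * l / (4 * k : ℕ))) - 1 := by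
  have hk' : (0 : ℝ) < k := by exact_mod_cast hk
  set g : ℕ → ℝ := fun l => (-1 : ℝ) ^ l * (1 / sin (π * l / (4 * k : ℕ))) with hg
  have h1 : cosecantSum (4 * k) (2 * k) = ∑ l ∈ Ico 1 (4 * k), g l := by
    apply sum_congr rfl
    intro l _
    have : 2 * π * ((2 * k : ℕ) : ℝ) * l / (4 * k : ℕ) = l * π := by
      push_cast; field_simp; ring
    rw [this, cos_nat_mul_pi]
  have hsym (l : ℕ) (hl : l ≤ 4 * k) : g (4 * k - l) = g l := by
    have e : π * ((4 * k - l : ℕ) : ℝ) / (4 * k : ℕ) = π - π * l / (4 * k : ℕ) := by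
      rw [Nat.cast_sub hl]; field_simp
    simp only [hg]
    rw [e, sin_pi_sub]
    congr 1
    have : (-1 : ℝ) ^ (4 * k - l) * (-1) ^ l = 1 := by
      rw [← pow_add, Nat.sub_add_cancel hl, show 4 * k = 2 * (2 * k) by ring, pow_mul]; simp
    have h2 : (-1 : ℝ) ^ l * (-1) ^ l = 1 := by rw [← mul_pow]; simp
    calc (-1 : ℝ) ^ (4 * k - l) = (-1) ^ (4 * k - l) * ((-1) ^ l * (-1) ^ l) := by
          rw [h2, mul_one]
      _ = _ := by rw [← mul_assoc, this, one_mul]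
  have hmid : g (2 * k) = 1 := by
    have : π * ((2 * k : ℕ) : ℝ) / (4 * k : ℕ) = π / 2 := by push_cast; field_simp; norm_num
    simp only [hg]
    rw [this, sin_pi_div_two, pow_mul]; simp
  have h2 : ∑ l ∈ Ico (2 * k) (4 * k), g l = ∑ l ∈ Icc 1 (2 * k), g l := by
    refine sum_bij' (fun l _ => 4 * k - l) (fun l _ => 4 * k - l) ?_ ?_ ?_ ?_ ?_
    · intro l hl; rw [mem_Ico] at hl; rw [mem_Icc]; omega
    · intro l hl; rw [mem_Icc] at hl; rw [mem_Ico]; omega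
    · intro l hl; rw [mem_Ico] at hl; omega
    · intro l hl; rw [mem_Icc] at hl; omega
    · intro l hl; rw [mem_Ico] at hl; exact (hsym l (by omega)).symm
  have h3 : ∑ l ∈ Icc 1 (2 * k), g l = ∑ l ∈ Ico 1 (2 * k), g l + 1 := by
    rw [← hmid, ← sum_Ico_succ_top (by omega)]
    rfl
  rw [h1, ← sum_Ico_consecutive g (show 1 ≤ 2 * k by omega) (show 2 * k ≤ 4 * k by omega), h2]
  linarith

/-- Splitting csc x = 1/x + `cscRegular x`, the harmonic part cancels the leading term up to a tail
tending to 2/π; the regular part gives 1 - 2/π, and the middle term, counted twice, gives -1. -/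
theorem tendsto_cosecantError_center :
    Tendsto (fun k : ℕ => cosecantError (4 * k) (2 * k)) atTop (𝓝 0) := by
  have h := (tendsto_mul_altHarmonicTail.add tendsto_alternating_sum_cscRegular).sub_const 1
  rw [show 2 / π + (1 - 2 / π) - 1 = 0 by ring] at h
  refine h.congr' ?_
  filter_upwards [eventually_ge_atTop 1] with k hk
  have hk' : (1 : ℝ) ≤ k := by exact_mod_cast hk
  have e : π * ((2 * k : ℕ) : ℝ) / (4 * k : ℕ) = π / 2 := by push_cast; field_simp; norm_num
  rw [cosecantError, cosecantSum_center k hk, leadingTerm, e, sin_pi_div_two, altHarmonicTail]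
  have : ∑ l ∈ Icc 1 (2 * k), (-1 : ℝ) ^ l * (1 / sin (π * l / (4 * k : ℕ)))
      = 4 * k / π * ∑ l ∈ Icc 1 (2 * k), (-1 : ℝ) ^ l * (1 / (l : ℝ))
        + ∑ l ∈ Icc 1 (2 * k), (-1 : ℝ) ^ l * cscRegular (π * l / (4 * k : ℕ)) := by
    rw [mul_sum, ← sum_add_distrib]
    apply sum_congr rfl
    intro l hl
    rw [mem_Icc] at hl
    have hl1 : (1 : ℝ) ≤ l := by exact_mod_cast hl.1
    have hl2 : (l : ℝ) ≤ 2 * k := by exact_mod_cast hl.2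
    rw [one_div_sin_eq_add_cscRegular (π * l / (4 * k : ℕ)) (by positivity) (by
      rw [div_lt_iff₀ (by positivity)]; push_cast; nlinarith [pi_pos])]
    push_cast
    field_simp
  rw [this, mul_one]
  push_cast
  ring

/-- Duplication and reflection give E_{8k}(2k) = E_{4k}(2k), and 2k lies left of the centre 4k of
modulus 8k. -/
theorem cosecantError_center_lt (k : ℕ) (hk : 1 ≤ k) :
    cosecantError (4 * k) (2 * k) < cosecantError (4 * (2 * k)) (2 * (2 * k)) := by
  have h1 := cosecantError_double (4 * k) (2 * k) (by omega) (by omega)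
  have h2 := cosecantError_reflect (2 * (4 * k)) (2 * k) (by omega) (by omega)
  have h3 := cosecantError_lt_of_lt (2 * (4 * k)) (2 * k) (2 * (2 * k)) (by omega) (by omega)
    (by omega)
  rw [show 2 * (4 * k) - 2 * k = 2 * k + 4 * k by omega] at h2
  rw [show 4 * (2 * k) = 2 * (4 * k) by ring]
  linarith

theorem cosecantError_center_neg (k : ℕ) (hk : 1 ≤ k) : cosecantError (4 * k) (2 * k) < 0 := by
  have hmono : StrictMono fun i : ℕ => cosecantError (4 * (2 ^ i * k)) (2 * (2 ^ i * k)) := by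
    refine strictMono_nat_of_lt_succ fun i => ?_
    have := cosecantError_center_lt (2 ^ i * k) (Nat.mul_pos (by positivity) hk)
    rw [pow_succ', mul_assoc]
    exact this
  have hsub : Tendsto (fun i : ℕ => 2 ^ i * k) atTop atTop :=
    (tendsto_pow_atTop_atTop_of_one_lt one_lt_two).atTop_mul_const' hk
  have hlim := tendsto_cosecantError_center.comp hsub
  -- The limit only bounds the term at i = 1 by 0; strict increase from i = 0 makes the original
  -- value negative.
  have h1 := hmono.monotone.ge_of_tendsto hlim 1
  have h0 := hmono (show 0 < 1 by norm_num)
  simp only [pow_zero, one_mul] at h0 h1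
  linarith

/-! ### Sign and size of the error for every modulus -/

theorem cosecantError_le_center (k ν : ℕ) (h1 : 1 ≤ ν) (h2 : ν < 4 * k) :
    cosecantError (4 * k) ν ≤ cosecantError (4 * k) (2 * k) := by
  have key (ν : ℕ) (h1 : 1 ≤ ν) (h2 : ν ≤ 2 * k) :
      cosecantError (4 * k) ν ≤ cosecantError (4 * k) (2 * k) := by
    rcases h2.eq_or_lt with rfl | h2
    · rfl
    · exact (cosecantError_lt_of_lt _ _ _ h1 (by omega) h2).le
  rcases le_total ν (2 * k) with h | h
  · exact key ν h1 h
  · rw [← cosecantError_reflect _ _ h2.le (by omega)]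
    exact key _ (by omega) (by omega)

theorem center_sub_le_cosecantError (k ν r : ℕ) (hr : 1 ≤ r) (h1 : r ≤ ν) (h2 : ν + r ≤ 4 * k) :
    cosecantError (4 * k) (2 * k) - 8 * k / (r : ℝ) ^ 2 ≤ cosecantError (4 * k) ν := by
  have hr' : (1 : ℝ) ≤ r := by exact_mod_cast hr
  have key (ν : ℕ) (h1 : r ≤ ν) (h2 : ν ≤ 2 * k) :
      cosecantError (4 * k) (2 * k) - 8 * k / (r : ℝ) ^ 2 ≤ cosecantError (4 * k) ν := by
    have h := cosecantError_le_add (4 * k) ν (2 * k) (by omega) (by omega) h2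
    have hν : (r : ℝ) ≤ ν := by exact_mod_cast h1
    have e : 2 * ((4 * k : ℕ) : ℝ) / (ν : ℝ) ^ 2 ≤ 8 * k / (r : ℝ) ^ 2 := by
      push_cast
      rw [show 2 * (4 * (k : ℝ)) = 8 * k by ring]
      gcongr
    have e2 : 0 ≤ 2 * ((4 * k : ℕ) : ℝ) / ((2 * k : ℕ) : ℝ) ^ 2 := by positivity
    linarith
  rcases le_total ν (2 * k) with h | h
  · exact key ν h1 h
  · rw [← cosecantError_reflect _ _ (show ν ≤ 4 * k by omega) (by omega)]
    exact key _ (by omega) (by omega)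

/-- Moves an arbitrary modulus k to 4k, where the central value is controlled. -/
theorem cosecantError_quadruple (k r : ℕ) (h1 : 1 ≤ r) (h2 : r < k) :
    cosecantError (4 * k) r + cosecantError (4 * k) (r + k) + cosecantError (4 * k) (r + 2 * k)
      + cosecantError (4 * k) (r + 3 * k) = 4 * cosecantError k r := by
  have a := cosecantError_double k r h1 h2
  have b := cosecantError_double (2 * k) r h1 (by omega)
  have c := cosecantError_double (2 * k) (r + k) (by omega) (by omega)
  rw [show 2 * (2 * k) = 4 * k by ring] at b c
  rw [show r + k + 2 * k = r + 3 * k by ring] at c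
  linarith

theorem cosecantError_neg (k r : ℕ) (h1 : 1 ≤ r) (h2 : r < k) : cosecantError k r < 0 := by
  have h := cosecantError_quadruple k r h1 h2
  have hc := cosecantError_center_neg k (by omega)
  have a0 := cosecantError_le_center k r h1 (by omega)
  have a1 := cosecantError_le_center k (r + k) (by omega) (by omega)
  have a2 := cosecantError_le_center k (r + 2 * k) (by omega) (by omega)
  have a3 := cosecantError_le_center k (r + 3 * k) (by omega) (by omega)
  linarith

/-- Since 2r ≤ k, the four points r + jk all keep distance at least r from 0 and 4k. -/
theorem abs_cosecantError_le (k r : ℕ) (h1 : 1 ≤ r) (h2 : 2 * r ≤ k) :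
    |cosecantError k r| ≤ |cosecantError (4 * k) (2 * k)| + 8 * k / (r : ℝ) ^ 2 := by
  have h := cosecantError_quadruple k r h1 (by omega)
  rw [abs_of_neg (cosecantError_neg k r h1 (by omega)),
    abs_of_neg (cosecantError_center_neg k (by omega))]
  have a0 := center_sub_le_cosecantError k r r h1 (by omega) (by omega)
  have a1 := center_sub_le_cosecantError k (r + k) r h1 (by omega) (by omega)
  have a2 := center_sub_le_cosecantError k (r + 2 * k) r h1 (by omega) (by omega)
  have a3 := center_sub_le_cosecantError k (r + 3 * k) r h1 (by omega) (by omega)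
  linarith

/-! ### Lower bound for the logarithm away from its zeros -/

theorem abs_sub_one_div_two_le_abs_log (y : ℝ) (h0 : 0 < y) (h2 : y ≤ 2) :
    |y - 1| / 2 ≤ |log y| := by
  rcases le_total y 1 with h | h
  · rw [abs_of_nonpos (by linarith), abs_of_nonpos (log_nonpos h0.le h)]
    linarith [log_le_sub_one_of_pos h0]
  · rw [abs_of_nonneg (by linarith), abs_of_nonneg (log_nonneg h)]
    have h3 := one_sub_inv_le_log_of_pos h0
    have : (y - 1) / 2 ≤ 1 - y⁻¹ := by
      rw [← sub_nonneg, show 1 - y⁻¹ - (y - 1) / 2 = (y - 1) * (2 - y) / (2 * y) by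
        field_simp]
      exact div_nonneg (mul_nonneg (by linarith) (by linarith)) (by linarith)
    linarith

theorem abs_sub_pi_div_six_le (x : ℝ) (h0 : 0 ≤ x) (h1 : x ≤ π / 2) :
    |x - π / 6| / π ≤ |sin x - 1 / 2| := by
  have hpi := pi_pos
  rw [← sin_pi_div_six, sin_sub_sin, abs_mul, abs_mul, abs_two]
  have hcos : 1 / 2 ≤ cos ((x + π / 6) / 2) := by
    rw [← cos_pi_div_three]
    exact cos_le_cos_of_nonneg_of_le_pi (by linarith) (by linarith) (by linarith)
  have hsin : 2 / π * |(x - π / 6) / 2| ≤ |sin ((x - π / 6) / 2)| :=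
    mul_abs_le_abs_sin (by rw [abs_le]; constructor <;> linarith)
  rw [abs_of_nonneg (show 0 ≤ cos ((x + π / 6) / 2) by linarith)]
  calc |x - π / 6| / π = 2 * (2 / π * |(x - π / 6) / 2|) * (1 / 2) := by
        rw [abs_div, abs_two]; field_simp
    _ ≤ _ := by gcongr

/-- The nonzero integer 6r - k has absolute value at least 1, so πr/k stays at least π/(6k) away
from π/6. -/
theorem one_div_le_abs_log_two_mul_sin (k r : ℕ) (h1 : 1 ≤ r) (h2 : 2 * r ≤ k) (h6 : 6 * r ≠ k) :
    1 / (6 * (k : ℝ)) ≤ |log (2 * sin (π * r / k))| := by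
  have hpi := pi_pos
  have hk : (0 : ℝ) < k := by exact_mod_cast (by omega : 0 < k)
  have h2' : 2 * (r : ℝ) ≤ k := by exact_mod_cast h2
  have hs := sin_pi_mul_div_pos k r h1 (by omega)
  refine le_trans ?_ (abs_sub_one_div_two_le_abs_log _ (by positivity)
    (by linarith [sin_le_one (π * r / k)]))
  have hx := abs_sub_pi_div_six_le (π * r / k) (by positivity) (by
    rw [div_le_div_iff₀ hk two_pos]; nlinarith)
  have hint : (1 : ℝ) ≤ |6 * (r : ℝ) - k| := by
    have : (1 : ℤ) ≤ |6 * (r : ℤ) - k| := Int.one_le_abs (by omega)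
    exact_mod_cast this
  have e : |π * r / k - π / 6| / π = |6 * (r : ℝ) - k| / (6 * k) := by
    rw [show π * r / k - π / 6 = (6 * (r : ℝ) - k) * (π / (6 * k)) by field_simp, abs_mul,
      abs_of_pos (show 0 < π / (6 * (k : ℝ)) by positivity)]
    field_simp
  have e2 : |2 * sin (π * r / k) - 1| / 2 = |sin (π * r / k) - 1 / 2| := by
    rw [show 2 * sin (π * r / k) - 1 = 2 * (sin (π * r / k) - 1 / 2) by ring, abs_mul, abs_two]
    ring
  rw [e2]
  refine le_trans ?_ hx
  rw [e]
  gcongr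

theorem abs_leadingTerm (k r : ℕ) :
    |leadingTerm k r| = 2 * k / π * |log (2 * sin (π * r / k))| := by
  rw [leadingTerm, abs_mul, abs_neg, abs_of_nonneg (by positivity)]

/-! ### The uniform estimate and the exceptional points -/

theorem exists_abs_cosecantError_le_mul_of_le_half (ε : ℝ) (hε : 0 < ε) :
    ∃ N : ℕ, ∀ k r : ℕ, N ≤ k → 1 ≤ r → 2 * r ≤ k → 6 * r ≠ k →
      |cosecantError k r| ≤ ε * |leadingTerm k r| := by
  have hpi := pi_pos
  -- The cut is at r² = Mk. Above it the central value and 8k/r² are each at most ε/(6π), in total ε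
  -- times the minimal leading term 1/(3π). Below it the error is at most 9k, and `hl` makes the
  -- logarithm at least 9π/(2ε) in absolute value.
  set M : ℝ := 48 * π / ε with hM
  have hMpos : 0 < M := by positivity
  have hd : ∀ᶠ k : ℕ in atTop, |cosecantError (4 * k) (2 * k)| < min (ε / (6 * π)) 1 := by
    have := tendsto_cosecantError_center.abs
    rw [abs_zero] at this
    exact this.eventually_lt_const (by positivity)
  have hl : ∀ᶠ k : ℕ in atTop, 9 * π / ε ≤ log ((k : ℝ) / (4 * π ^ 2 * M)) :=
    (tendsto_log_atTop.comp
      (tendsto_natCast_atTop_atTop.atTop_div_const (by positivity))).eventually_ge_atTop _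
  obtain ⟨N, hN⟩ := eventually_atTop.1 (hd.and hl)
  refine ⟨N, fun k r hk h1 h2 h6 => ?_⟩
  obtain ⟨hδ, hlog⟩ := hN k hk
  have hk0 : (1 : ℝ) ≤ k := by exact_mod_cast (by omega : 1 ≤ k)
  have hr0 : (1 : ℝ) ≤ r := by exact_mod_cast h1
  refine (abs_cosecantError_le k r h1 h2).trans ?_
  rw [abs_leadingTerm]
  rcases le_or_gt (M * k) ((r : ℝ) ^ 2) with hc | hc
  · have hL := one_div_le_abs_log_two_mul_sin k r h1 h2 h6
    calc _ ≤ ε / (6 * π) + 8 * k / (M * k) := by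
          gcongr
          exact hδ.le.trans (min_le_left _ _)
      _ = ε * (2 * k / π * (1 / (6 * (k : ℝ)))) := by rw [hM]; field_simp; norm_num
      _ ≤ _ := by gcongr
  · have hs := sin_pi_mul_div_pos k r h1 (by omega)
    have hy : (2 * sin (π * r / k)) ^ 2 ≤ 4 * π ^ 2 * M / k := by
      have : sin (π * r / k) ≤ π * r / k := sin_le (by positivity)
      calc (2 * sin (π * r / k)) ^ 2 ≤ (2 * (π * r / k)) ^ 2 := by gcongr
        _ = 4 * π ^ 2 * (r : ℝ) ^ 2 / k ^ 2 := by ring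
        _ ≤ 4 * π ^ 2 * (M * k) / k ^ 2 := by gcongr
        _ = _ := by field_simp
    have hlog2 := log_le_log (by positivity) hy
    rw [log_pow, ← inv_div (k : ℝ) (4 * π ^ 2 * M), log_inv] at hlog2
    push_cast at hlog2
    have hlow : 9 * π / (2 * ε) ≤ |log (2 * sin (π * r / k))| := by
      have e : 9 * π / (2 * ε) = 9 * π / ε / 2 := by field_simp
      rw [e]
      refine le_trans ?_ (neg_le_abs _)
      linarith
    calc _ ≤ 1 * (k : ℝ) + 8 * k / 1 ^ 2 := by
          gcongr
          linarith [hδ.trans_le (min_le_right _ _)]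
      _ = ε * (2 * k / π * (9 * π / (2 * ε))) := by field_simp; norm_num
      _ ≤ _ := by gcongr

theorem exists_abs_cosecantError_le_mul (ε : ℝ) (hε : 0 < ε) :
    ∃ N : ℕ, ∀ k r : ℕ, N ≤ k → 1 ≤ r → r < k → 6 * r ≠ k → 6 * r ≠ 5 * k →
      |cosecantError k r| ≤ ε * |leadingTerm k r| := by
  obtain ⟨N, hN⟩ := exists_abs_cosecantError_le_mul_of_le_half ε hε
  refine ⟨N, fun k r hk h1 h2 h6 h5 => ?_⟩
  rcases le_total (2 * r) k with h | h
  · exact hN k r hk h1 h h6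
  · rw [← cosecantError_reflect k r h2.le (by omega), ← leadingTerm_reflect k r h2.le (by omega)]
    exact hN k (k - r) hk (by omega) (by omega) (by omega)

theorem log_two_mul_sin_eq_zero (n ν : ℕ) (hn : 1 ≤ n) (h : 6 * ν = n ∨ 6 * ν = 5 * n) :
    log (2 * sin (π * (ν : ℝ) / (n : ℝ))) = 0 := by
  have hn' : (0 : ℝ) < n := by exact_mod_cast hn
  have key : sin (π * (ν : ℝ) / (n : ℝ)) = 1 / 2 := by
    rcases h with h | h
    · have h' : 6 * (ν : ℝ) = n := by exact_mod_cast h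
      rw [show π * (ν : ℝ) / n = π / 6 by field_simp; linarith, sin_pi_div_six]
    · have h' : 6 * (ν : ℝ) = 5 * n := by exact_mod_cast h
      rw [show π * (ν : ℝ) / n = π - π / 6 by field_simp; linarith, sin_pi_sub, sin_pi_div_six]
  rw [key]; norm_num

theorem cosecantSum_neg_of_log_eq_zero (n ν : ℕ) (h1 : 1 ≤ ν) (h2 : ν < n)
    (h : 6 * ν = n ∨ 6 * ν = 5 * n) : cosecantSum n ν < 0 := by
  have hE := cosecantError_neg n ν h1 h2
  rwa [cosecantError, leadingTerm, log_two_mul_sin_eq_zero n ν (by omega) h, mul_zero,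
    sub_zero] at hE

theorem not_isEquivalent_of_log_eq_zero (c : ℕ) (h1 : 1 ≤ c) (h2 : c < 6) (h : c = 1 ∨ c = 5) :
    ¬ Asymptotics.IsEquivalent atTop
      (fun m : ℕ => cosecantSum (6 * m) (c * m)) (fun m : ℕ => leadingTerm (6 * m) (c * m)) := by
  intro hequiv
  have hsix (m : ℕ) : 6 * (c * m) = 6 * m ∨ 6 * (c * m) = 5 * (6 * m) := by
    rcases h with rfl | rfl
    · left; ring
    · right; ring
  have hzero : (fun m : ℕ => leadingTerm (6 * m) (c * m)) =ᶠ[atTop] 0 := by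
    filter_upwards [eventually_ge_atTop 1] with m hm
    rw [leadingTerm, log_two_mul_sin_eq_zero _ _ (by omega) (hsix m), mul_zero, Pi.zero_apply]
  -- Equivalence to an eventually zero sequence forces eventual vanishing, which negativity of the
  -- sum excludes.
  have h0 := Asymptotics.isEquivalent_zero_iff_eventually_zero.1 (hequiv.congr_right hzero)
  obtain ⟨m, hm, hm1⟩ := (h0.and (eventually_ge_atTop 1)).exists
  refine (cosecantSum_neg_of_log_eq_zero (6 * m) (c * m) (Nat.mul_pos h1 hm1) ?_ (hsix m)).ne hm
  exact Nat.mul_lt_mul_of_pos_right h2 hm1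

theorem mainTheorem10 :
    Asymptotics.IsEquivalent largeAdmissible
        (fun p : ℕ × ℕ => cosecantSum p.1 p.2) (fun p : ℕ × ℕ => leadingTerm p.1 p.2) ∧
      (∀ n ν : ℕ, 1 ≤ n → (6 * ν = n ∨ 6 * ν = 5 * n) →
        Real.log (2 * Real.sin (Real.pi * (ν : ℝ) / (n : ℝ))) = 0) ∧
      ¬ Asymptotics.IsEquivalent Filter.atTop
          (fun m : ℕ => cosecantSum (6 * m) m) (fun m : ℕ => leadingTerm (6 * m) m) ∧
      ¬ Asymptotics.IsEquivalent Filter.atTop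
          (fun m : ℕ => cosecantSum (6 * m) (5 * m))
          (fun m : ℕ => leadingTerm (6 * m) (5 * m)) := by
  refine ⟨?_, log_two_mul_sin_eq_zero, ?_,
    not_isEquivalent_of_log_eq_zero 5 (by norm_num) (by norm_num) (Or.inr rfl)⟩
  · refine Asymptotics.isLittleO_iff.2 fun ε hε => ?_
    obtain ⟨N, hN⟩ := exists_abs_cosecantError_le_mul ε hε
    rw [largeAdmissible, eventually_inf_principal]
    filter_upwards [preimage_mem_comap (Filter.mem_atTop N)] with p hp hadm
    exact hN p.1 p.2 hp hadm.1 hadm.2.1 hadm.2.2.1 hadm.2.2.2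
  · simpa only [one_mul] using
      not_isEquivalent_of_log_eq_zero 1 le_rfl (by norm_num) (Or.inl rfl)
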